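/- Let $\mathcal{B}$ be a complete Boolean algebra with unity $\mathbf{1}$, let $Q$ be its Stone space, and for $e\in\mathcal{B}$ let $Q(e)\subset Q$ be the corresponding clopen set. Let $C(Q)$ be the algebra of continuous functions $Q\to\mathbb{R}$, and let $L^0(\mathcal{B})=C_\infty(Q)$ be the set of all continuous functions $x\colon Q\to[-\infty,+\infty]$ that take the values $\pm\infty$ on a nowhere dense set only. It is a commutative $\mathbb{R}$-algebra and a vector lattice: the order is pointwise, and each algebraic operation gives the unique continuous extension of the function computed pointwise on the dense open set where the functions involved are finite. Identify $e\in\mathcal{B}$ with the indicator function of $Q(e)$, an idempotent of $L^0(\mathcal{B})$, and regard $C(Q)$ as a subalgebra of $L^0(\mathcal{B})$. The support of $x\in L^0(\mathcal{B})$ is $s(x)=\mathbf{1}-\sup\{e\in\mathcal{B}: ex=0\}\in\mathcal{B}$. A solid space in $L^0(\mathcal{B})$ is a non-zero linear subspace $Y$ such that $x\in Y$, $y\in L^0(\mathcal{B})$ and $|y|\leqslant|x|$ imply $y\in Y$. A derivation $\delta\colon C(Q)\to Y$ is an $\mathbb{R}$-linear map with $\delta(ab)=\delta(a)b+a\delta(b)$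 for all $a,b\in C(Q)$, the products being computed in $L^0(\mathcal{B})$; its support is $s(\delta)=\sup\{s(\delta(a)): a\in C(Q)\}\in\mathcal{B}$. **Theorem.** Let $\mathcal{B}$ be a complete Boolean algebra, let $Q$ be the Stone space of $\mathcal{B}$, let $Y$ be a solid space in $L^0(\mathcal{B})$ and let $\delta\colon C(Q)\to Y$ be a non-zero derivation. Then $s(\delta)Y=s(\delta)L^0(\mathcal{B})$, where $eE=\{ex: x\in E\}$ for $e\in\mathcal{B}$ and $E\subset L^0(\mathcal{B})$. In particular, if $s(\delta)=\mathbf{1}$, then $Y=L^0(\mathcal{B})$. -/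

import Mathlib

open Set Filter Topology

noncomputable section

universe u

/-! ## The Stone space of a Boolean algebra -/

/-- The Stone space of a Boolean algebra `B`: its points are the Boolean homomorphisms
`B → {0, 1}` (equivalently, the ultrafilters of `B`). -/
def StoneSpace (B : Type u) [BooleanAlgebra B] : Type u := BoundedLatticeHom B Bool

namespace StoneSpace

section Boolean

variable {B : Type u} [BooleanAlgebra B]

/-- The value of a point of the Stone space, seen as a homomorphism, at `e`. -/
def val (t : StoneSpace B) : B → Bool := fun e => BoundedLatticeHom.toLatticeHom t e

/-- The topology of pointwise convergence. -/
instance : TopologicalSpace (StoneSpace B) := TopologicalSpace.induced val inferInstance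

/-- The set `Q(e)` of all points of the Stone space at which `e` takes the value `1`. -/
def basic (e : B) : Set (StoneSpace B) := {t | t.val e = true}

lemma val_injective : Function.Injective (val : StoneSpace B → B → Bool) := by
  intro s t h
  apply DFunLike.ext (F := BoundedLatticeHom B Bool) s t
  intro e
  exact congrFun h e

lemma val_sup (t : StoneSpace B) (a b : B) : t.val (a ⊔ b) = (t.val a || t.val b) :=
  map_sup (BoundedLatticeHom.toLatticeHom t) a b

lemma val_inf (t : StoneSpace B) (a b : B) : t.val (a ⊓ b) = (t.val a && t.val b) :=
  map_inf (BoundedLatticeHom.toLatticeHom t) a b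

lemma val_top (t : StoneSpace B) : t.val ⊤ = true :=
  map_top (F := BoundedLatticeHom B Bool) t

lemma val_bot (t : StoneSpace B) : t.val ⊥ = false :=
  map_bot (F := BoundedLatticeHom B Bool) t

lemma val_compl (t : StoneSpace B) (a : B) : t.val aᶜ = !(t.val a) := by
  have h1 := val_sup t a aᶜ
  have h2 := val_inf t a aᶜ
  rw [sup_compl_eq_top, val_top] at h1
  rw [inf_compl_eq_bot, val_bot] at h2
  revert h1 h2
  cases t.val a <;> cases t.val aᶜ <;> simp

lemma continuous_val : Continuous (val : StoneSpace B → B → Bool) := continuous_induced_dom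

lemma isClopen_basic (e : B) : IsClopen (basic e) :=
  (isClopen_discrete {true}).preimage ((continuous_apply e).comp continuous_val)

lemma basic_compl (e : B) : basic eᶜ = (basic e)ᶜ := by
  ext t
  simp [basic, val_compl]

lemma basic_inf (a b : B) : basic (a ⊓ b) = basic a ∩ basic b := by
  ext t
  simp [basic, val_inf]

lemma range_val : range (val : StoneSpace B → B → Bool) =
    {f | f ⊤ = true ∧ f ⊥ = false ∧ ∀ a b, f (a ⊔ b) = (f a || f b) ∧
      f (a ⊓ b) = (f a && f b)} := by
  ext f
  constructor
  · rintro ⟨t, rfl⟩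
    exact ⟨val_top t, val_bot t, fun a b => ⟨val_sup t a b, val_inf t a b⟩⟩
  · rintro ⟨h1, h2, h3⟩
    exact ⟨({ toFun := f
              map_sup' := fun a b => (h3 a b).1
              map_inf' := fun a b => (h3 a b).2
              map_top' := h1
              map_bot' := h2 } : BoundedLatticeHom B Bool), rfl⟩

instance : T2Space (StoneSpace B) :=
  T2Space.of_injective_continuous val_injective continuous_val

instance : CompactSpace (StoneSpace B) := by
  have hi : IsInducing (val : StoneSpace B → B → Bool) := ⟨rfl⟩
  rw [← isCompact_univ_iff, hi.isCompact_iff, image_univ, range_val]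
  apply IsClosed.isCompact
  simp only [ofPred_and, ofPred_forall]
  refine (isClosed_eq (continuous_apply _) continuous_const).inter
    ((isClosed_eq (continuous_apply _) continuous_const).inter
      (isClosed_iInter fun a => isClosed_iInter fun b => IsClosed.inter ?_ ?_))
  · exact isClosed_eq (continuous_apply _)
      (continuous_of_discreteTopology (f := fun p : Bool × Bool => (p.1 || p.2)) |>.comp
        (g := fun p : Bool × Bool => (p.1 || p.2)) (f := fun f : B → Bool => (f a, f b))
        ((continuous_apply a).prodMk (continuous_apply b)))
  · exact isClosed_eq (continuous_apply _)
      (continuous_of_discreteTopology (f := fun p : Bool × Bool => (p.1 && p.2)) |>.comp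
        (g := fun p : Bool × Bool => (p.1 && p.2)) (f := fun f : B → Bool => (f a, f b))
        ((continuous_apply a).prodMk (continuous_apply b)))

lemma basic_nonempty {e : B} (he : e ≠ ⊥) : (basic e).Nonempty := by
  classical
  have hd : Disjoint ((Order.PFilter.principal e : Order.PFilter B) : Set B)
      ((Order.Ideal.principal (⊥ : B)) : Set B) := by
    rw [Set.disjoint_left]
    intro x hx hx'
    have h1 : e ≤ x := hx
    have h2 : x ≤ ⊥ := hx'
    exact he (le_bot_iff.1 (h1.trans h2))
  obtain ⟨J, hJ, -, hdJ⟩ := DistribLattice.prime_ideal_of_disjoint_filter_ideal hd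
  have heJ : e ∉ J := fun h => Set.disjoint_left.1 hdJ (le_refl e) h
  have htop : (⊤ : B) ∉ J := fun h => heJ (J.lower le_top h)
  refine ⟨({ toFun := fun x => decide (x ∉ J)
             map_sup' := fun a b => ?_
             map_inf' := fun a b => ?_
             map_top' := ?_
             map_bot' := ?_ } : BoundedLatticeHom B Bool), ?_⟩
  · by_cases ha : a ∈ J <;> by_cases hb : b ∈ J <;> simp [Order.Ideal.sup_mem_iff, ha, hb]
  · have h : a ⊓ b ∈ J ↔ a ∈ J ∨ b ∈ J :=
      ⟨fun h => hJ.mem_or_mem h, fun h => h.elim (J.lower inf_le_left) (J.lower inf_le_right)⟩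
    by_cases ha : a ∈ J <;> by_cases hb : b ∈ J <;> simp [h, ha, hb]
  · simpa using htop
  · simp
  · change decide (e ∉ J) = true
    simpa using heJ

/-- The sets `Q(e)` form a base of the topology. -/
lemma exists_basic_subset {U : Set (StoneSpace B)} (hU : IsOpen U) {t : StoneSpace B}
    (ht : t ∈ U) : ∃ e : B, t ∈ basic e ∧ basic e ⊆ U := by
  obtain ⟨V, hV, rfl⟩ := isOpen_induced_iff.1 hU
  obtain ⟨I, w, hw, hsub⟩ := isOpen_pi_iff.1 hV _ ht
  have key : ∀ I : Finset B, ∃ e : B, t ∈ basic e ∧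
      ∀ s ∈ basic e, ∀ a ∈ I, s.val a = t.val a := by
    classical
    intro I
    induction I using Finset.induction_on with
    | empty => exact ⟨⊤, val_top t, by simp⟩
    | insert a I _ ih =>
      obtain ⟨e, he, hI⟩ := ih
      have ha : ∃ c : B, t ∈ basic c ∧ ∀ s ∈ basic c, s.val a = t.val a := by
        cases h : t.val a
        · refine ⟨aᶜ, ?_, fun s hs => ?_⟩
          · simp [basic, val_compl, h]
          · simpa [basic, val_compl] using hs
        · exact ⟨a, h, fun s hs => hs⟩
      obtain ⟨c, hc, hca⟩ := ha
      refine ⟨e ⊓ c, ?_, fun s hs b hb => ?_⟩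
      · rw [basic_inf]
        exact ⟨he, hc⟩
      · rw [basic_inf] at hs
        rcases Finset.mem_insert.1 hb with rfl | hb
        · exact hca s hs.2
        · exact hI s hs.1 b hb
  obtain ⟨e, he, hI⟩ := key I
  refine ⟨e, he, fun s hs => hsub ?_⟩
  intro a ha
  rw [hI s hs a ha]
  exact (hw a ha).2

end Boolean

/-- The Stone space of a complete Boolean algebra is extremally disconnected. -/
instance {B : Type u} [CompleteBooleanAlgebra B] : ExtremallyDisconnected (StoneSpace B) where
  open_closure U hU := by
    have h : closure U = basic (sSup {e : B | basic e ⊆ U}) := by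
      apply Subset.antisymm
      · refine closure_minimal (fun t ht => ?_) (isClopen_basic _).1
        obtain ⟨e, he, heU⟩ := exists_basic_subset hU ht
        have hle : e ≤ sSup {e : B | basic e ⊆ U} := le_sSup heU
        have h2 := val_inf t e (sSup {e : B | basic e ⊆ U})
        rw [inf_eq_left.2 hle, show t.val e = true from he] at h2
        simpa [basic] using h2.symm
      · intro t ht
        by_contra hcl
        obtain ⟨c, hc, hcU⟩ := exists_basic_subset isClosed_closure.isOpen_compl hcl
        have hsup : sSup {e : B | basic e ⊆ U} ≤ cᶜ := by
          refine sSup_le fun e he => ?_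
          rw [le_compl_iff_disjoint_right, disjoint_iff]
          by_contra hne
          obtain ⟨s, hs⟩ := basic_nonempty hne
          rw [basic_inf] at hs
          exact hcU hs.2 (subset_closure (he hs.1))
        have h2 := val_inf t (sSup {e : B | basic e ⊆ U}) cᶜ
        rw [inf_eq_left.2 hsup, show t.val _ = true from ht, val_compl,
          show t.val c = true from hc] at h2
        simp at h2
    rw [h]
    exact (isClopen_basic _).2

end StoneSpace

/-! ## The algebra and vector lattice `C_∞(Q)` -/

/-- `C_∞(Q)`: the continuous functions `x : Q → [-∞, +∞]` that take the values `±∞` on a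
nowhere dense set only. -/
structure CInfty (Q : Type u) [TopologicalSpace Q] : Type u where
  toFun : Q → EReal
  continuous_toFun : Continuous toFun
  nowhereDense : IsNowhereDense {t | toFun t = ⊥ ∨ toFun t = ⊤}

namespace CInfty

section Basic

variable {Q : Type u} [TopologicalSpace Q]

instance : CoeFun (CInfty Q) (fun _ => Q → EReal) := ⟨toFun⟩

lemma coe_injective : Function.Injective (toFun : CInfty Q → Q → EReal) := by
  rintro ⟨x, _, _⟩ ⟨y, _, _⟩ h
  cases h
  rfl

/-- The set of points at which `x` is finite. -/
def fin (x : CInfty Q) : Set Q := {t | x t ≠ ⊥ ∧ x t ≠ ⊤}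

/-- The real value of `x` (meaningful at the points where `x` is finite). -/
def re (x : CInfty Q) (t : Q) : ℝ := (x t).toReal

lemma coe_re (x : CInfty Q) {t : Q} (ht : t ∈ x.fin) : ((x.re t : ℝ) : EReal) = x t :=
  EReal.coe_toReal ht.2 ht.1

lemma isOpen_fin (x : CInfty Q) : IsOpen x.fin :=
  (isOpen_ne.preimage x.continuous_toFun).inter (isOpen_ne.preimage x.continuous_toFun)

lemma dense_fin (x : CInfty Q) : Dense x.fin := by
  have h := x.nowhereDense
  have hc : {t | x t = ⊥ ∨ x t = ⊤} = x.finᶜ := by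
    ext t
    simp only [fin, mem_ofPred_eq, mem_compl_iff]
    tauto
  rw [hc, IsNowhereDense, x.isOpen_fin.isClosed_compl.closure_eq, interior_compl] at h
  rw [dense_iff_closure_eq]
  simpa using h

lemma continuousOn_re (x : CInfty Q) : ContinuousOn x.re x.fin :=
  EReal.continuousOn_toReal.comp x.continuous_toFun.continuousOn (fun t ht => by
    have h1 := ht.1
    have h2 := ht.2
    simp [h1, h2])

lemma isNowhereDense_compl {D : Set Q} (hD : IsOpen D) (hd : Dense D) {s : Set Q}
    (hs : s ⊆ Dᶜ) : IsNowhereDense s := by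
  refine IsNowhereDense.mono hs ?_
  rw [IsNowhereDense, hD.isClosed_compl.closure_eq, interior_compl, hd.closure_eq, compl_univ]

/-- Two elements which agree on a dense set are equal. -/
lemma ext_dense {x y : CInfty Q} {D : Set Q} (hd : Dense D) (h : ∀ t ∈ D, x t = y t) :
    x = y :=
  coe_injective (Continuous.ext_on hd x.continuous_toFun y.continuous_toFun h)

/-- The order of `C_∞(Q)` is the pointwise one. -/
instance : LE (CInfty Q) := ⟨fun x y => ∀ t, x t ≤ y t⟩

instance : LT (CInfty Q) := ⟨fun x y => x ≤ y ∧ ¬ y ≤ x⟩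

instance : Max (CInfty Q) := ⟨fun x y =>
  ⟨fun t => max (x t) (y t), x.continuous_toFun.max y.continuous_toFun,
    isNowhereDense_compl (x.isOpen_fin.inter y.isOpen_fin)
      (x.dense_fin.inter_of_isOpen_left y.dense_fin x.isOpen_fin) (by
        rintro t ht ⟨h1, h2⟩
        rcases max_choice (x t) (y t) with h | h
        · rw [mem_ofPred_eq, h] at ht
          exact ht.elim h1.1 h1.2
        · rw [mem_ofPred_eq, h] at ht
          exact ht.elim h2.1 h2.2)⟩⟩

instance : Min (CInfty Q) := ⟨fun x y =>
  ⟨fun t => min (x t) (y t), x.continuous_toFun.min y.continuous_toFun,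
    isNowhereDense_compl (x.isOpen_fin.inter y.isOpen_fin)
      (x.dense_fin.inter_of_isOpen_left y.dense_fin x.isOpen_fin) (by
        rintro t ht ⟨h1, h2⟩
        rcases min_choice (x t) (y t) with h | h
        · rw [mem_ofPred_eq, h] at ht
          exact ht.elim h1.1 h1.2
        · rw [mem_ofPred_eq, h] at ht
          exact ht.elim h2.1 h2.2)⟩⟩

/-- The lattice structure of `C_∞(Q)` is the pointwise one. -/
instance : Lattice (CInfty Q) :=
  Function.Injective.lattice (toFun : CInfty Q → Q → EReal) coe_injective
    Iff.rfl (by intro x y; exact lt_iff_le_not_ge) (fun _ _ => rfl) (fun _ _ => rfl)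

/-- A continuous real-valued function, as an element of `C_∞(Q)`. -/
def ofC (f : C(Q, ℝ)) : CInfty Q where
  toFun t := ((f t : ℝ) : EReal)
  continuous_toFun := continuous_coe_real_ereal.comp f.continuous
  nowhereDense := by simp

lemma fin_ofC (f : C(Q, ℝ)) : (ofC f).fin = univ := by
  ext t
  simp [fin, ofC]

@[simp] lemma re_ofC (f : C(Q, ℝ)) (t : Q) : (ofC f).re t = f t := EReal.toReal_coe _

instance : Zero (CInfty Q) := ⟨ofC 0⟩

instance : One (CInfty Q) := ⟨ofC 1⟩

/-- The filter of the sets which contain a dense open set. -/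
def denseOpen (Q : Type u) [TopologicalSpace Q] : Filter Q where
  sets := {s | ∃ D ⊆ s, IsOpen D ∧ Dense D}
  univ_sets := ⟨univ, subset_rfl, isOpen_univ, dense_univ⟩
  sets_of_superset := by
    rintro s s' ⟨D, hDs, h⟩ hs
    exact ⟨D, hDs.trans hs, h⟩
  inter_sets := by
    rintro s s' ⟨D, hDs, hD, hd⟩ ⟨D', hDs', hD', hd'⟩
    exact ⟨D ∩ D', inter_subset_inter hDs hDs', hD.inter hD',
      hd.inter_of_isOpen_left hd' hD⟩

lemma eventually_fin (x : CInfty Q) : ∀ᶠ t in denseOpen Q, t ∈ x.fin :=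
  ⟨x.fin, subset_rfl, x.isOpen_fin, x.dense_fin⟩

/-- Elements with the same real values on a dense open set are equal. -/
lemma ext_re {x y : CInfty Q} (h : x.re =ᶠ[denseOpen Q] y.re) : x = y := by
  obtain ⟨D, hDs, -, hd⟩ := (h.and (x.eventually_fin.and y.eventually_fin))
  refine ext_dense hd fun t ht => ?_
  obtain ⟨h1, h2, h3⟩ := hDs ht
  rw [← coe_re x h2, ← coe_re y h3, h1]

@[simp] lemma re_zero (t : Q) : (0 : CInfty Q).re t = 0 := re_ofC 0 t

@[simp] lemma re_one (t : Q) : (1 : CInfty Q).re t = 1 := re_ofC 1 t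

end Basic

section Algebra

variable {Q : Type u} [TopologicalSpace Q] [ExtremallyDisconnected Q]

/-- In an extremally disconnected space a function which is continuous on a dense open set and
has values in a compact Hausdorff space has a limit at every point. -/
lemma exists_tendsto {K : Type*} [TopologicalSpace K] [CompactSpace K] [T2Space K]
    {D : Set Q} (hD : IsOpen D) (hd : Dense D) {f : Q → K} (hf : ContinuousOn f D) (t : Q) :
    ∃ y, Tendsto f (𝓝[D] t) (𝓝 y) := by
  have : (𝓝[D] t).NeBot := mem_closure_iff_nhdsWithin_neBot.1 (hd t)
  obtain ⟨c, hc⟩ := exists_clusterPt_of_compactSpace (map f (𝓝[D] t))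
  refine ⟨c, le_nhds_of_unique_clusterPt fun c' hc' => ?_⟩
  by_contra hne
  obtain ⟨V, W, hV, hW, hcV, hcW, hVW⟩ := t2_separation hne
  have key : ∀ {a : K} {U : Set K}, IsOpen U → a ∈ U → ClusterPt a (map f (𝓝[D] t)) →
      t ∈ closure (D ∩ f ⁻¹' U) := by
    intro a U hU ha hcl
    have h1 : ∃ᶠ z in map f (𝓝[D] t), z ∈ U :=
      hcl.frequently (hU.mem_nhds ha)
    rw [frequently_map, frequently_nhdsWithin_iff] at h1
    rw [mem_closure_iff_frequently]
    exact h1.mono fun z hz => ⟨hz.2, hz.1⟩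
  have h1 := key hV hcV hc'
  have h2 := key hW hcW hc
  have hdis : Disjoint (D ∩ f ⁻¹' V) (D ∩ f ⁻¹' W) :=
    (hVW.preimage f).mono inter_subset_right inter_subset_right
  have o1 := hf.isOpen_inter_preimage hD hV
  have o2 := hf.isOpen_inter_preimage hD hW
  have h3 := (hdis.closure_right o1).closure_left (ExtremallyDisconnected.open_closure _ o2)
  exact Set.disjoint_left.1 h3 h1 h2

/-- The element of `C_∞(Q)` which extends a real function that is continuous on a dense open
set `D` (see `lift_apply`); it is unique by `ext_dense`. -/
def lift (D : Set Q) (hD : IsOpen D) (hd : Dense D) (f : Q → ℝ) (hf : ContinuousOn f D) :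
    CInfty Q where
  toFun := extendFrom D (fun t => ((f t : ℝ) : EReal))
  continuous_toFun := continuous_extendFrom hd
    (exists_tendsto hD hd (continuous_coe_real_ereal.comp_continuousOn hf))
  nowhereDense := isNowhereDense_compl hD hd (by
    intro t ht htD
    have h : extendFrom D (fun t => ((f t : ℝ) : EReal)) t = ((f t : ℝ) : EReal) :=
      extendFrom_extends (continuous_coe_real_ereal.comp_continuousOn hf) t htD
    rw [mem_ofPred_eq, h] at ht
    simp at ht)

lemma lift_apply {D : Set Q} (hD : IsOpen D) (hd : Dense D) {f : Q → ℝ}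
    (hf : ContinuousOn f D) {t : Q} (ht : t ∈ D) : lift D hD hd f hf t = ((f t : ℝ) : EReal) :=
  extendFrom_extends (continuous_coe_real_ereal.comp_continuousOn hf) t ht

/-- The sum: the extension of the pointwise sum from the set where both functions are finite. -/
instance : Add (CInfty Q) := ⟨fun x y => lift (x.fin ∩ y.fin) (x.isOpen_fin.inter y.isOpen_fin)
  (x.dense_fin.inter_of_isOpen_left y.dense_fin x.isOpen_fin) (fun t => x.re t + y.re t)
  ((x.continuousOn_re.mono inter_subset_left).add (y.continuousOn_re.mono inter_subset_right))⟩

/-- The product: the extension of the pointwise product from the set where both functions are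
finite. -/
instance : Mul (CInfty Q) := ⟨fun x y => lift (x.fin ∩ y.fin) (x.isOpen_fin.inter y.isOpen_fin)
  (x.dense_fin.inter_of_isOpen_left y.dense_fin x.isOpen_fin) (fun t => x.re t * y.re t)
  ((x.continuousOn_re.mono inter_subset_left).mul (y.continuousOn_re.mono inter_subset_right))⟩

instance : Neg (CInfty Q) := ⟨fun x => lift x.fin x.isOpen_fin x.dense_fin (fun t => -x.re t)
  x.continuousOn_re.neg⟩

instance : SMul ℝ (CInfty Q) := ⟨fun c x => lift x.fin x.isOpen_fin x.dense_fin
  (fun t => c * x.re t) (continuousOn_const.mul x.continuousOn_re)⟩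

lemma re_lift {D : Set Q} (hD : IsOpen D) (hd : Dense D) {f : Q → ℝ}
    (hf : ContinuousOn f D) : (lift D hD hd f hf).re =ᶠ[denseOpen Q] f :=
  ⟨D, fun t ht => by
    change (lift D hD hd f hf t).toReal = f t
    rw [lift_apply hD hd hf ht, EReal.toReal_coe], hD, hd⟩

lemma re_add (x y : CInfty Q) : (x + y).re =ᶠ[denseOpen Q] fun t => x.re t + y.re t := re_lift ..

lemma re_mul (x y : CInfty Q) : (x * y).re =ᶠ[denseOpen Q] fun t => x.re t * y.re t := re_lift ..

lemma re_neg (x : CInfty Q) : (-x).re =ᶠ[denseOpen Q] fun t => -x.re t := re_lift ..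

lemma re_smul (c : ℝ) (x : CInfty Q) : (c • x).re =ᶠ[denseOpen Q] fun t => c * x.re t :=
  re_lift ..

instance : CommRing (CInfty Q) where
  add_assoc x y z := ext_re <| by
    filter_upwards [re_add (x + y) z, re_add x y, re_add x (y + z), re_add y z] with t h1 h2 h3 h4
    rw [h1, h2, h3, h4, add_assoc]
  zero_add x := ext_re <| by
    filter_upwards [re_add 0 x] with t h1
    rw [h1, re_zero, zero_add]
  add_zero x := ext_re <| by
    filter_upwards [re_add x 0] with t h1
    rw [h1, re_zero, add_zero]
  add_comm x y := ext_re <| by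
    filter_upwards [re_add x y, re_add y x] with t h1 h2
    rw [h1, h2, add_comm]
  neg_add_cancel x := ext_re <| by
    filter_upwards [re_add (-x) x, re_neg x] with t h1 h2
    rw [h1, h2, re_zero, neg_add_cancel]
  mul_assoc x y z := ext_re <| by
    filter_upwards [re_mul (x * y) z, re_mul x y, re_mul x (y * z), re_mul y z] with t h1 h2 h3 h4
    rw [h1, h2, h3, h4, mul_assoc]
  mul_comm x y := ext_re <| by
    filter_upwards [re_mul x y, re_mul y x] with t h1 h2
    rw [h1, h2, mul_comm]
  one_mul x := ext_re <| by
    filter_upwards [re_mul 1 x] with t h1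
    rw [h1, re_one, one_mul]
  mul_one x := ext_re <| by
    filter_upwards [re_mul x 1] with t h1
    rw [h1, re_one, mul_one]
  zero_mul x := ext_re <| by
    filter_upwards [re_mul 0 x] with t h1
    rw [h1, re_zero, zero_mul]
  mul_zero x := ext_re <| by
    filter_upwards [re_mul x 0] with t h1
    rw [h1, re_zero, mul_zero]
  left_distrib x y z := ext_re <| by
    filter_upwards [re_mul x (y + z), re_add y z, re_add (x * y) (x * z), re_mul x y, re_mul x z]
      with t h1 h2 h3 h4 h5
    rw [h1, h2, h3, h4, h5, mul_add]
  right_distrib x y z := ext_re <| by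
    filter_upwards [re_mul (x + y) z, re_add x y, re_add (x * z) (y * z), re_mul x z, re_mul y z]
      with t h1 h2 h3 h4 h5
    rw [h1, h2, h3, h4, h5, add_mul]
  nsmul := nsmulRec
  zsmul := zsmulRec

instance : Module ℝ (CInfty Q) where
  one_smul x := ext_re <| by
    filter_upwards [re_smul 1 x] with t h1
    rw [h1, one_mul]
  mul_smul a b x := ext_re <| by
    filter_upwards [re_smul (a * b) x, re_smul a (b • x), re_smul b x] with t h1 h2 h3
    rw [h1, h2, h3, mul_assoc]
  smul_zero a := ext_re <| by
    filter_upwards [re_smul a (0 : CInfty Q)] with t h1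
    rw [h1, re_zero, mul_zero]
  smul_add a x y := ext_re <| by
    filter_upwards [re_smul a (x + y), re_add x y, re_add (a • x) (a • y), re_smul a x,
      re_smul a y] with t h1 h2 h3 h4 h5
    rw [h1, h2, h3, h4, h5, mul_add]
  add_smul a b x := ext_re <| by
    filter_upwards [re_smul (a + b) x, re_add (a • x) (b • x), re_smul a x, re_smul b x]
      with t h1 h2 h3 h4
    rw [h1, h2, h3, h4, add_mul]
  zero_smul x := ext_re <| by
    filter_upwards [re_smul 0 x] with t h1
    rw [h1, re_zero, zero_mul]

instance : Algebra ℝ (CInfty Q) := Algebra.ofModule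
  (fun a x y => ext_re <| by
    filter_upwards [re_mul (a • x) y, re_smul a x, re_smul a (x * y), re_mul x y]
      with t h1 h2 h3 h4
    rw [h1, h2, h3, h4, mul_assoc])
  (fun a x y => ext_re <| by
    filter_upwards [re_mul x (a • y), re_smul a y, re_smul a (x * y), re_mul x y]
      with t h1 h2 h3 h4
    rw [h1, h2, h3, h4, mul_left_comm])

end Algebra

end CInfty

/-! ## `L⁰(B)`, supports, solid spaces and derivations -/

section Main

variable {B : Type u} [CompleteBooleanAlgebra B]

/-- `L⁰(B) = C_∞(Q)`, where `Q` is the Stone space of the complete Boolean algebra `B`. -/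
abbrev LZero (B : Type u) [CompleteBooleanAlgebra B] : Type u := CInfty (StoneSpace B)

namespace LZero

/-- The idempotent of `L⁰(B)` given by `e ∈ B`: the indicator function of the clopen set `Q(e)`. -/
def idem (e : B) : LZero B :=
  CInfty.ofC
    ⟨(StoneSpace.basic e).indicator (fun _ => (1 : ℝ)),
      (StoneSpace.isClopen_basic e).continuous_indicator continuous_const⟩

/-- The support `s(x) = 1 - sup {e ∈ B : e x = 0}` of an element of `L⁰(B)`. -/
def supp (x : LZero B) : B := (sSup {e : B | idem e * x = 0})ᶜ

/-- A solid space: a non-zero linear subspace `Y` of `L⁰(B)` such that `x ∈ Y` and `|y| ≤ |x|`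
imply `y ∈ Y`. -/
structure IsSolidSpace (Y : Submodule ℝ (LZero B)) : Prop where
  ne_bot : Y ≠ ⊥
  solid : ∀ x ∈ Y, ∀ y : LZero B, |y| ≤ |x| → y ∈ Y

/-- A linear map from `C(Q)` to a linear subspace `Y` of `L⁰(B)` is a derivation if it satisfies
the Leibniz rule (whose terms are computed in the algebra `L⁰(B)`). -/
def IsDerivation {Y : Submodule ℝ (LZero B)} (δ : C(StoneSpace B, ℝ) →ₗ[ℝ] Y) : Prop :=
  ∀ a b : C(StoneSpace B, ℝ),
    (δ (a * b) : LZero B) = (δ a : LZero B) * CInfty.ofC b + CInfty.ofC a * (δ b : LZero B)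

/-- The support `s(δ) = sup {s(δ(a)) : a ∈ C(Q)}` of a linear map from `C(Q)` to a linear subspace
of `L⁰(B)`. -/
def derivSupp {Y : Submodule ℝ (LZero B)} (δ : C(StoneSpace B, ℝ) →ₗ[ℝ] Y) : B :=
  ⨆ a : C(StoneSpace B, ℝ), supp (δ a : LZero B)

end LZero

end Main

end

/-! The theorem reduces to a domination statement: every `z` in `L⁰(B)` admits `a` in `C(Q)` with
`|s(δ) z| ≤ |δ(a)|`. Solidity then puts `s(δ) z` in `Y`.

The domination comes from an amplification. Suppose `δ(b)` is finite and non-zero at a point `t`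
where `z` is finite. A derivation kills constants and commutes with multiplication by idempotents,
so on a clopen neighbourhood of `t` the function `n (b - b(t))` has derivative `n δ(b)`. For large
`n` this exceeds `z` near `t`, while a smaller neighbourhood keeps the function itself inside `[-1,
1]`. Arbitrarily large derivatives are thus reached from uniformly bounded functions
(`IsDerivation.exists_dominating_local`).

Uniform boundedness makes the pieces glue. A maximal disjoint family of such clopen sets has dense
union, and since `Q` is extremally disconnected a continuous map from this union to the compact
interval `[-1, 1]` extends to `Q` (`exists_continuousMap_eqOn`). Locality of `δ`
(`IsDerivation.eventually_re_eq`) identifies the derivative of the glued function on each piece, and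
the inequality passes to the closure. -/

open CInfty StoneSpace

/-! ### Pointwise inequalities and gluing on extremally disconnected spaces -/

section Extension

variable {Q : Type*} [TopologicalSpace Q]

lemma CInfty.ofC_one : ofC (1 : C(Q, ℝ)) = 1 := rfl

variable [ExtremallyDisconnected Q]

/-- The absolute value of `C_∞(Q)` is the pointwise one. -/
lemma CInfty.re_abs (x : CInfty Q) : |x|.re =ᶠ[denseOpen Q] fun t => |x.re t| := by
  filter_upwards [re_neg x, x.eventually_fin, (-x).eventually_fin] with t h1 h2 h3
  have h : |x| t = max (x t) ((-x) t) := rfl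
  rw [CInfty.re, h, ← coe_re x h2, ← coe_re (-x) h3, h1,
    ← EReal.coe_strictMono.monotone.map_max, EReal.toReal_coe]
  rfl

/-- An inequality between real values on a dense open set extends to the closure of an open
set. -/
lemma CInfty.abs_apply_le_of_re {x y : CInfty Q} {U : Set Q} (hU : IsOpen U)
    (h : ∀ᶠ t in denseOpen Q, t ∈ U → |x.re t| ≤ |y.re t|) {t : Q} (ht : t ∈ closure U) :
    |x| t ≤ |y| t := by
  have hcl : IsClosed {t | |x| t ≤ |y| t} :=
    isClosed_le (|x|).continuous_toFun (|y|).continuous_toFun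
  obtain ⟨D, hDs, -, hd⟩ := h.and ((re_abs x).and ((re_abs y).and
    ((|x|).eventually_fin.and (|y|).eventually_fin)))
  have hsub : U ∩ D ⊆ {t | |x| t ≤ |y| t} := by
    rintro s ⟨hsU, hsD⟩
    obtain ⟨h1, h2, h3, h4, h5⟩ := hDs hsD
    change |x| s ≤ |y| s
    rw [← coe_re _ h4, ← coe_re _ h5, h2, h3, EReal.coe_le_coe_iff]
    exact h1 hsU
  exact closure_minimal hsub hcl
    (closure_minimal (hd.open_subset_closure_inter hU) isClosed_closure ht)

/-- Conversely, a pointwise inequality of absolute values passes to the real values. -/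
lemma CInfty.eventually_abs_re_le {x y : CInfty Q} :
    ∀ᶠ t in denseOpen Q, |x| t ≤ |y| t → |x.re t| ≤ |y.re t| := by
  filter_upwards [re_abs x, re_abs y, (|x|).eventually_fin, (|y|).eventually_fin]
    with t h1 h2 h3 h4 h
  rwa [← coe_re _ h3, ← coe_re _ h4, h1, h2, EReal.coe_le_coe_iff] at h

lemma CInfty.ofC_mul (f g : C(Q, ℝ)) : ofC (f * g) = ofC f * ofC g := ext_re <| by
  filter_upwards [re_mul (ofC f) (ofC g)] with t h
  rw [h]
  simp

/-- A family of continuous functions with values in `[-1, 1]` can be mixed along pairwise disjoint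
open sets with dense union. -/
lemma exists_continuousMap_eqOn {ι : Type*} {U : ι → Set Q} (hU : ∀ i, IsOpen (U i))
    (hdis : Pairwise fun i j => Disjoint (U i) (U j)) (hd : Dense (⋃ i, U i))
    (A : ι → C(Q, ℝ)) (hA : ∀ i t, A i t ∈ Icc (-1 : ℝ) 1) :
    ∃ a : C(Q, ℝ), ∀ i, EqOn a (A i) (U i) := by
  classical
  let f : Q → Icc (-1 : ℝ) 1 := fun t =>
    if h : ∃ i, t ∈ U i then ⟨A h.choose t, hA _ t⟩ else ⟨0, by norm_num, by norm_num⟩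
  have hf : ∀ i, ∀ t ∈ U i, f t = ⟨A i t, hA i t⟩ := by
    intro i t ht
    have h : ∃ i, t ∈ U i := ⟨i, ht⟩
    have hi : h.choose = i := by
      by_contra hne
      exact Set.disjoint_left.1 (hdis hne) h.choose_spec ht
    simp only [f, dif_pos h, hi]
  have hO : IsOpen (⋃ i, U i) := isOpen_iUnion hU
  have hc : ContinuousOn f (⋃ i, U i) := by
    intro t ht
    obtain ⟨i, hi⟩ := mem_iUnion.1 ht
    refine ContinuousAt.continuousWithinAt ?_
    have hg : Continuous fun t => (⟨A i t, hA i t⟩ : Icc (-1 : ℝ) 1) :=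
      (A i).continuous.subtype_mk _
    exact hg.continuousAt.congr (mem_of_superset ((hU i).mem_nhds hi) fun s hs => (hf i s hs).symm)
  refine ⟨⟨fun t => ((extendFrom (⋃ i, U i) f t : Icc (-1 : ℝ) 1) : ℝ), continuous_subtype_val.comp
    (continuous_extendFrom hd fun t => exists_tendsto hO hd hc t)⟩, fun i t ht => ?_⟩
  change ((extendFrom (⋃ i, U i) f t : Icc (-1 : ℝ) 1) : ℝ) = A i t
  rw [extendFrom_extends hc t (mem_iUnion.2 ⟨i, ht⟩), hf i t ht]

end Extension

/-! ### Exhaustion in Boolean algebras -/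

/-- In a Boolean algebra, if the elements with a property `P` are order-dense, then there is a
pairwise disjoint family of them which meets every non-zero element. -/
lemma exists_pairwise_disjoint_of_dense {B : Type*} [BooleanAlgebra B] {P : B → Prop}
    (hP : ∀ e : B, e ≠ ⊥ → ∃ c ≤ e, c ≠ ⊥ ∧ P c) :
    ∃ S : Set B, (∀ e ∈ S, P e) ∧ S.Pairwise Disjoint ∧ ∀ e : B, e ≠ ⊥ → ∃ c ∈ S, c ⊓ e ≠ ⊥ := by
  obtain ⟨S, hS⟩ := zorn_subset {S : Set B | (∀ e ∈ S, P e) ∧ S.Pairwise Disjoint} (by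
    intro c hc hchain
    refine ⟨⋃₀ c, ⟨?_, ?_⟩, fun s hs => subset_sUnion_of_mem hs⟩
    · rintro e ⟨s, hs, he⟩
      exact (hc hs).1 e he
    · exact (pairwise_sUnion hchain.directedOn).2 fun s hs => (hc hs).2)
  refine ⟨S, hS.prop.1, hS.prop.2, fun e he => ?_⟩
  by_contra! hcon
  obtain ⟨c, hce, hc, hPc⟩ := hP e he
  have hdis : ∀ d ∈ S, Disjoint c d := fun d hd =>
    (disjoint_iff.2 (hcon d hd)).symm.mono_left hce
  -- Maximality of `S` forces `c` into `S`, so `c` is disjoint from itself, contradicting `c ≠ ⊥`.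
  have hmem : c ∈ S := hS.le_of_ge (y := insert c S)
    ⟨fun d hd => hd.elim (fun h => h ▸ hPc) (hS.prop.1 d),
      hS.prop.2.insert_of_symm fun d hd _ => hdis d hd⟩
    (subset_insert c S) (mem_insert c S)
  exact hc (disjoint_self.1 (hdis c hmem))

/-! ### Idempotents and supports -/

namespace LZero

variable {B : Type*} [CompleteBooleanAlgebra B]

/-- The indicator function of `Q(e)` as an element of `C(Q)`. -/
noncomputable def idemC (e : B) : C(StoneSpace B, ℝ) :=
  ⟨(basic e).indicator (fun _ => (1 : ℝ)),
    (isClopen_basic e).continuous_indicator continuous_const⟩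

lemma ofC_idemC (e : B) : ofC (idemC e) = idem e := rfl

lemma idemC_of_mem {e : B} {t : StoneSpace B} (ht : t ∈ basic e) : idemC e t = 1 :=
  indicator_of_mem ht (fun _ => (1 : ℝ))

lemma idemC_of_notMem {e : B} {t : StoneSpace B} (ht : t ∉ basic e) : idemC e t = 0 :=
  indicator_of_notMem ht (fun _ => (1 : ℝ))

lemma idemC_mul_self (e : B) : idemC e * idemC e = idemC e := by
  ext t
  by_cases ht : t ∈ basic e
  · simp [idemC_of_mem ht]
  · simp [idemC_of_notMem ht]

lemma idem_mul_self (e : B) : idem e * idem e = idem e := by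
  rw [← ofC_idemC, ← ofC_mul, idemC_mul_self]

lemma idem_top : idem (⊤ : B) = 1 := by
  rw [← ofC_idemC, ← ofC_one]
  congr 1
  ext t
  exact idemC_of_mem (val_top t)

lemma re_idem_mul (e : B) (x : LZero B) :
    (idem e * x).re =ᶠ[denseOpen _] fun t => idemC e t * x.re t := by
  filter_upwards [re_mul (idem e) x] with t h
  rw [h, ← ofC_idemC, re_ofC]

/-- A non-zero part of the support of `x` contains a point at which `x` does not vanish and
`x` and `z` are finite. -/
lemma exists_mem_basic_of_inf_supp {e : B} {x : LZero B} (h : e ⊓ supp x ≠ ⊥) (z : LZero B) :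
    ∃ t ∈ basic e, t ∈ x.fin ∧ t ∈ z.fin ∧ x.re t ≠ 0 := by
  by_contra! hcon
  refine h ?_
  -- Finiteness of `x` and `z` holds on a dense open set, so vanishing of `x` at such points of
  -- `Q(e)` already gives `e x = 0`.
  have h0 : idem e * x = 0 := ext_re <| by
    filter_upwards [re_idem_mul e x, x.eventually_fin, z.eventually_fin] with t h1 h2 h3
    rw [h1, re_zero]
    by_cases ht : t ∈ basic e
    · rw [hcon t ht h2 h3, mul_zero]
    · rw [idemC_of_notMem ht, zero_mul]
  exact disjoint_iff.1 (disjoint_compl_right.mono_left (le_sSup h0))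

/-! ### Derivations: locality and domination -/

variable {Y : Submodule ℝ (LZero B)} {δ : C(StoneSpace B, ℝ) →ₗ[ℝ] Y}

/-- Multiplying `δ(p) = 2 p δ(p)` by `p` gives `p δ(p) = 2 p δ(p)`, hence `p δ(p) = 0` and then
`δ(p) = 0`. It is applied to indicators and to the constant 1. -/
lemma IsDerivation.map_of_mul_self (hδ : IsDerivation δ) {p : C(StoneSpace B, ℝ)}
    (hp : p * p = p) : (δ p : LZero B) = 0 := by
  have h1 := hδ p p
  have h2 : ofC p * ofC p = ofC p := by rw [← ofC_mul, hp]
  rw [hp] at h1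
  have h3 : ofC p * (δ p : LZero B) = 0 := by
    linear_combination (-ofC p) * h1 - 2 * (δ p : LZero B) * h2
  linear_combination h1 + 2 * h3

lemma IsDerivation.map_idemC_mul (hδ : IsDerivation δ) (e : B) (a : C(StoneSpace B, ℝ)) :
    (δ (idemC e * a) : LZero B) = idem e * (δ a : LZero B) := by
  rw [hδ, hδ.map_of_mul_self (idemC_mul_self e), zero_mul, zero_add, ofC_idemC]

/-- Derivations are local. -/
lemma IsDerivation.eventually_re_eq (hδ : IsDerivation δ) {e : B} {a b : C(StoneSpace B, ℝ)}
    (h : EqOn a b (basic e)) : ∀ᶠ t in denseOpen (StoneSpace B), t ∈ basic e →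
      (δ a : LZero B).re t = (δ b : LZero B).re t := by
  have h1 : idemC e * a = idemC e * b := by
    ext t
    by_cases ht : t ∈ basic e
    · simp [h ht]
    · simp [idemC_of_notMem ht]
  have h2 : idem e * (δ a : LZero B) = idem e * (δ b : LZero B) := by
    rw [← hδ.map_idemC_mul, ← hδ.map_idemC_mul, h1]
  filter_upwards [re_idem_mul e (δ a : LZero B), re_idem_mul e (δ b : LZero B)] with t h3 h4 ht
  rw [← h2, h3, idemC_of_mem ht, one_mul, one_mul] at h4
  exact h4

/-- Locally, within the support of a derivation, any element of `L⁰(B)` is dominated by the value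
of the derivation at some function bounded by one. -/
lemma IsDerivation.exists_dominating_local (hδ : IsDerivation δ) (z : LZero B) {e : B}
    (he : e ⊓ derivSupp δ ≠ ⊥) :
    ∃ c ≤ e, c ≠ ⊥ ∧ ∃ a : C(StoneSpace B, ℝ), (∀ t, a t ∈ Icc (-1 : ℝ) 1) ∧
      ∀ t ∈ basic c, |z| t ≤ |(δ a : LZero B)| t := by
  obtain ⟨b, hb⟩ : ∃ b, e ⊓ supp (δ b : LZero B) ≠ ⊥ := by
    by_contra! hcon
    refine he ?_
    rw [derivSupp, inf_iSup_eq]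
    simp [hcon]
  obtain ⟨t, hte, htx, htz, ht0⟩ := exists_mem_basic_of_inf_supp hb z
  set x : LZero B := (δ b : LZero B) with hx
  -- The amplification factor: `n |x| > |z|` at `t`, a strict inequality that persists nearby.
  obtain ⟨n, hn⟩ := exists_nat_gt (|z.re t| / |x.re t|)
  have hn0 : (0 : ℝ) < n := lt_of_le_of_lt (by positivity) hn
  rw [div_lt_iff₀ (abs_pos.2 ht0)] at hn
  have hev : ∀ᶠ s in 𝓝 t, s ∈ basic e ∧ |z.re s| < n * |x.re s| ∧ |b s - b t| < 1 / n := by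
    refine Filter.Eventually.and ((isClopen_basic e).isOpen.mem_nhds hte)
      (Filter.Eventually.and ?_ ?_)
    · exact (z.continuousOn_re.continuousAt (z.isOpen_fin.mem_nhds htz)).abs.eventually_lt
        ((x.continuousOn_re.continuousAt (x.isOpen_fin.mem_nhds htx)).abs.const_mul _) hn
    · have hc : ContinuousAt (fun s => |b s - b t|) t := by fun_prop
      exact hc.eventually_lt continuousAt_const (by simpa using hn0)
  obtain ⟨V, hV, hVo, htV⟩ := mem_nhds_iff.1 hev
  obtain ⟨d, htd, hdV⟩ := exists_basic_subset hVo htV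
  have hcd : basic (d ⊓ e) ⊆ basic d := by
    rw [basic_inf]
    exact inter_subset_left
  -- Subtracting the constant `b t` does not affect the derivative but makes the function smaller
  -- than `1 / n` near `t`, so the factor `n` keeps it in `[-1, 1]`.
  refine ⟨d ⊓ e, inf_le_right, ?_, (n : ℝ) • (idemC (d ⊓ e) * (b - b t • 1)), ?_, ?_⟩
  · intro hbot
    have h1 : t ∈ basic (d ⊓ e) := by
      rw [basic_inf]
      exact ⟨htd, hte⟩
    rw [hbot, basic, mem_ofPred_eq, val_bot] at h1
    simp at h1
  · intro s
    rw [mem_Icc, ← abs_le]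
    by_cases hs : s ∈ basic (d ⊓ e)
    · have h1 := (hV (hdV (hcd hs))).2.2
      rw [lt_div_iff₀ hn0] at h1
      simp only [ContinuousMap.smul_apply, ContinuousMap.mul_apply, ContinuousMap.sub_apply,
        ContinuousMap.one_apply, smul_eq_mul, idemC_of_mem hs, mul_one, one_mul, abs_mul,
        Nat.abs_cast]
      linarith
    · simp [idemC_of_notMem hs]
  · have h1 : (δ ((n : ℝ) • (idemC (d ⊓ e) * (b - b t • 1))) : LZero B) =
        (n : ℝ) • (idem (d ⊓ e) * x) := by
      rw [map_smul, Submodule.coe_smul, hδ.map_idemC_mul, map_sub, map_smul, Submodule.coe_sub,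
        Submodule.coe_smul, hδ.map_of_mul_self (mul_one 1), smul_zero, sub_zero]
    rw [h1]
    intro s hs
    refine abs_apply_le_of_re (isClopen_basic (d ⊓ e)).isOpen ?_ (subset_closure hs)
    filter_upwards [re_smul (n : ℝ) (idem (d ⊓ e) * x), re_idem_mul (d ⊓ e) x] with r h2 h3 hr
    rw [h2, h3, idemC_of_mem hr, one_mul, abs_mul, Nat.abs_cast]
    exact (hV (hdV (hcd hr))).2.1.le

/-- Within the support of a derivation, any element of `L⁰(B)` is dominated by some value of the
derivation. -/
lemma IsDerivation.exists_dominating (hδ : IsDerivation δ) (z : LZero B) :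
    ∃ a : C(StoneSpace B, ℝ), |idem (derivSupp δ) * z| ≤ |(δ a : LZero B)| := by
  set w : LZero B := idem (derivSupp δ) * z with hw
  obtain ⟨S, hSP, hSd, hSm⟩ := exists_pairwise_disjoint_of_dense
    (P := fun c : B => ∃ a : C(StoneSpace B, ℝ), (∀ t, a t ∈ Icc (-1 : ℝ) 1) ∧
      ∀ t ∈ basic c, |w| t ≤ |(δ a : LZero B)| t) (by
    intro e he
    -- Off the support `w` vanishes, so `a = 0` works there. Covering this case makes the good
    -- elements order-dense in all of `B`, so that the pieces have dense union in `Q`.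
    by_cases hes : e ⊓ derivSupp δ = ⊥
    · refine ⟨e, le_rfl, he, 0, fun t => by simp, fun t ht => ?_⟩
      refine abs_apply_le_of_re (isClopen_basic e).isOpen ?_ (subset_closure ht)
      filter_upwards [re_idem_mul (derivSupp δ) z] with s h1 hs
      have h2 : s ∉ basic (derivSupp δ) := by
        intro h2
        have h3 : s ∈ basic (e ⊓ derivSupp δ) := by
          rw [basic_inf]
          exact ⟨hs, h2⟩
        rw [hes, basic, mem_ofPred_eq, val_bot] at h3
        simp at h3
      rw [hw, h1, idemC_of_notMem h2, zero_mul, abs_zero]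
      exact abs_nonneg _
    · exact hδ.exists_dominating_local w hes)
  choose A hA1 hA2 using fun c : S => hSP c c.2
  have hdense : Dense (⋃ c : S, basic (c : B)) := by
    refine dense_iff_inter_open.2 fun V hV ⟨t, ht⟩ => ?_
    obtain ⟨e, hte, heV⟩ := exists_basic_subset hV ht
    obtain ⟨c, hc, hce⟩ := hSm e (by
      rintro rfl
      rw [basic, mem_ofPred_eq, val_bot] at hte
      simp at hte)
    obtain ⟨s, hs⟩ := basic_nonempty hce
    rw [basic_inf] at hs
    exact ⟨s, heV hs.2, mem_iUnion.2 ⟨⟨c, hc⟩, hs.1⟩⟩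
  obtain ⟨a, ha⟩ := exists_continuousMap_eqOn (fun c : S => (isClopen_basic (c : B)).isOpen)
    (fun c d hcd => by
      change Disjoint (basic (c : B)) (basic (d : B))
      rw [Set.disjoint_iff_inter_eq_empty, ← basic_inf,
        disjoint_iff.1 (hSd c.2 d.2 fun h => hcd (Subtype.ext h))]
      ext t
      simp [basic, val_bot]) hdense A hA1
  refine ⟨a, fun t => ?_⟩
  -- On `Q(c)` the glued `a` equals `A c`, so by locality `δ a` and `δ (A c)` have the same real
  -- values on a dense open part of `Q(c)`.
  have hsub : ⋃ c : S, basic (c : B) ⊆ {t | |w| t ≤ |(δ a : LZero B)| t} := by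
    refine iUnion_subset fun c s hs => ?_
    refine abs_apply_le_of_re (isClopen_basic (c : B)).isOpen ?_ (subset_closure hs)
    filter_upwards [hδ.eventually_re_eq (ha c), eventually_abs_re_le (x := w)
      (y := (δ (A c) : LZero B))] with r h1 h2 hr
    rw [h1 hr]
    exact h2 (hA2 c r hr)
  exact closure_minimal hsub
    (isClosed_le (|w|).continuous_toFun (|(δ a : LZero B)|).continuous_toFun) (hdense t)

end LZero

/-! ### The main theorem -/

theorem mainTheorem9 {B : Type*} [CompleteBooleanAlgebra B]
    (Y : Submodule ℝ (LZero B)) (hY : LZero.IsSolidSpace Y)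
    (δ : C(StoneSpace B, ℝ) →ₗ[ℝ] Y) (hδ : LZero.IsDerivation δ) (hδ0 : δ ≠ 0) :
    (fun y : LZero B => LZero.idem (LZero.derivSupp δ) * y) '' (Y : Set (LZero B)) =
        (fun y : LZero B => LZero.idem (LZero.derivSupp δ) * y) '' (Set.univ : Set (LZero B)) ∧
      (LZero.derivSupp δ = ⊤ → Y = ⊤) := by
  have key : ∀ z : LZero B, LZero.idem (LZero.derivSupp δ) * z ∈ Y := by
    intro z
    obtain ⟨a, ha⟩ := hδ.exists_dominating z
    exact hY.solid _ (δ a).2 _ ha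
  refine ⟨Set.Subset.antisymm (Set.image_mono (Set.subset_univ _)) ?_, fun h => ?_⟩
  · rintro _ ⟨z, -, rfl⟩
    -- The preimage is `s(δ) z` itself, since `s(δ)` acts as an idempotent.
    refine ⟨_, key z, ?_⟩
    simp only
    rw [← mul_assoc, LZero.idem_mul_self]
  · refine Submodule.eq_top_iff'.2 fun z => ?_
    have hz := key z
    rwa [h, LZero.idem_top, one_mul] at hz
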